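/- **Theorem.** Let $\mathsf H$ be a separable real Hilbert space, let $(\Omega,\mathcal F,\mathsf P)$ be a complete probability space, and let $\mathsf Z\subset\mathsf H$ be nonempty and closed. Let $(x_n)_{n\in\mathbb N}$ be a sequence of $\mathsf H$-valued random variables with $x_0\in L^2(\Omega,\mathcal F,\mathsf P;\mathsf H)$, and set $\mathcal X_n=\sigma(x_0,\dots,x_n)$ for every $n\in\mathbb N$. Suppose that, for every $n\in\mathbb N$, there are $t_n^*\in L^2(\Omega,\mathcal F,\mathsf P;\mathsf H)$, $\eta_n\in L^1(\Omega,\mathcal F,\mathsf P;\mathbb R)$, $\varepsilon_n\colon\Omega\times\mathsf H\to[0,+\infty[$, and $\lambda_n\in L^\infty(\Omega,\mathcal X_n,\mathsf P;\,]0,2[)$ such that the following hold. 1. $\varepsilon_n$ is a Carathéodory integrand ($\varepsilon_n(\omega,\cdot)$ is continuous for $\mathsf P$-almost every $\omega$, and $\varepsilon_n(\cdot,\mathsf y)$ is $\mathcal F$-measurable for every $\mathsf y\in\mathsf H$) and $\int_\Omega\varepsilon_n(\omega,y(\omega))\,\mathsf P(d\omega)<+\infty$ for every $y\in L^2(\Omega,\mathcal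 F,\mathsf P;\mathsf H)$. 2. The random variable equal to $\eta_n/\|t_n^*\|$ where $t_n^*\neq 0$ and $\langle x_n,t_n^*\rangle>\eta_n$, and to $0$ elsewhere, is in $L^2(\Omega,\mathcal F,\mathsf P;\mathbb R)$. 3. With $\alpha_n=(\langle x_n,t_n^*\rangle-\eta_n)/\|t_n^*\|^2$ where $t_n^*\neq 0$ and $\langle x_n,t_n^*\rangle>\eta_n$, and $\alpha_n=0$ elsewhere, $$(\forall \mathsf z\in\mathsf Z)\quad\big\langle \mathsf z,\mathsf E(\alpha_n t_n^*\mid\mathcal X_n)\big\rangle\le\mathsf E(\alpha_n\eta_n\mid\mathcal X_n)+\varepsilon_n(\cdot,\mathsf z)\quad\mathsf P\text{-a.s.}$$ 4. $x_{n+1}=x_n-\lambda_n\alpha_n t_n^*$ $\mathsf P$-a.s. Suppose further that, for every $\mathsf z\in\mathsf Z$, $\sum_{n\in\mathbb N}\lambda_n\varepsilon_n(\cdot,\mathsf z)<+\infty$ $\mathsf P$-a.s., and that, $\mathsf P$-a.s., every weak sequential cluster point of $(x_n)_{n\in\mathbb N}$ lies in $\mathsf Z$. Then $(x_n)_{n\in\mathbb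 N}$ converges weakly $\mathsf P$-a.s. to a $\mathsf Z$-valued random variable $x$. If, in addition, $\sum_{n\in\mathbb N}\mathsf E\big(\lambda_n\varepsilon_n(\cdot,\mathsf z)\big)<+\infty$ for every $\mathsf z\in\mathsf Z$, then every $x_n$ and $x$ lie in $L^2(\Omega,\mathcal F,\mathsf P;\mathsf H)$ and $(x_n)_{n\in\mathbb N}$ converges weakly in $L^2(\Omega,\mathcal F,\mathsf P;\mathsf H)$ to $x$. -/

import Mathlib

open MeasureTheory Filter Topology

noncomputable section

namespace StochasticOuterApproximation

/-- Weak convergence of a sequence in a real normed space: convergence for the weak topology. -/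
def WeaklyConverges {E : Type*} [NormedAddCommGroup E] [NormedSpace ℝ E]
    (u : ℕ → E) (a : E) : Prop :=
  Tendsto (fun n => toWeakSpace ℝ E (u n)) atTop (𝓝 (toWeakSpace ℝ E a))

/-- The set of weak sequential cluster points of a sequence: the weak limits of its
subsequences. -/
def weakSeqClusterPts {E : Type*} [NormedAddCommGroup E] [NormedSpace ℝ E]
    (u : ℕ → E) : Set E :=
  {a | ∃ k : ℕ → ℕ, StrictMono k ∧ WeaklyConverges (fun n => u (k n)) a}

/-- The σ-algebra `σ(x₀, …, xₙ)`. -/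
@[reducible]
def pastSigma {Ω H : Type*} [MeasurableSpace H] (x : ℕ → Ω → H) (n : ℕ) : MeasurableSpace Ω :=
  ⨆ k ≤ n, MeasurableSpace.comap (x k) inferInstance

/-- The class of nonnegative Carathéodory integrands `φ : Ω × H → [0, ∞[` such that
`ω ↦ φ (ω, y ω)` has a finite integral for every `y ∈ L²(Ω; H)`. -/
structure IsCaratheodoryClass {Ω H : Type*} [MeasurableSpace Ω] (P : Measure Ω)
    [NormedAddCommGroup H] (φ : Ω → H → ℝ) : Prop where
  nonneg : ∀ ω y, 0 ≤ φ ω y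
  continuous : ∀ᵐ ω ∂P, Continuous (φ ω)
  measurable : ∀ y, Measurable fun ω => φ ω y
  integrable : ∀ y : Ω → H, MemLp y 2 P → Integrable (fun ω => φ ω (y ω)) P

section

variable {H : Type*} [NormedAddCommGroup H] [InnerProductSpace ℝ H]

open Classical in
/-- The step `α = 1_{t ≠ 0} 1_{⟨x, t⟩ > η} (⟨x, t⟩ - η) / (‖t‖² + 1_{t = 0})`. -/
def stepCoeff (x t : H) (η : ℝ) : ℝ :=
  if t ≠ 0 ∧ η < inner ℝ x t then (inner ℝ x t - η) / ‖t‖ ^ 2 else 0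

open Classical in
/-- The quantity `1_{t ≠ 0} 1_{⟨x, t⟩ > η} η / (‖t‖ + 1_{t = 0})`. -/
def activeLevel (x t : H) (η : ℝ) : ℝ :=
  if t ≠ 0 ∧ η < inner ℝ x t then η / ‖t‖ else 0

variable {Ω : Type*} [MeasurableSpace Ω] [MeasurableSpace H]

/-- `x` is a sequence generated by the stochastic outer approximation algorithm for the set `Z`,
with outer normals `t`, levels `η`, tolerances `ε` and relaxation parameters `lam`. Random
variables are functions, and identities between them are almost sure ones. -/
structure IsOuterApproxSeq [CompleteSpace H] (P : Measure Ω) (Z : Set H) (x t : ℕ → Ω → H)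
    (η : ℕ → Ω → ℝ) (ε : ℕ → Ω → H → ℝ) (lam : ℕ → Ω → ℝ) : Prop where
  measurable_iterate : ∀ n, Measurable (x n)
  memLp_zero : MemLp (x 0) 2 P
  memLp_normal : ∀ n, MemLp (t n) 2 P
  integrable_level : ∀ n, Integrable (η n) P
  memLp_activeLevel : ∀ n, MemLp (fun ω => activeLevel (x n ω) (t n ω) (η n ω)) 2 P
  tolerance_nonneg : ∀ n, ∀ z ∈ Z, ∀ᵐ ω ∂P, 0 ≤ ε n ω z
  integrable_tolerance : ∀ n, ∀ z ∈ Z, Integrable (fun ω => ε n ω z) P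
  outer_approx : ∀ n, ∀ z ∈ Z, ∀ᵐ ω ∂P,
    inner ℝ z ((P[fun ω' => stepCoeff (x n ω') (t n ω') (η n ω') • t n ω' | pastSigma x n]) ω)
      ≤ (P[fun ω' => stepCoeff (x n ω') (t n ω') (η n ω') * η n ω' | pastSigma x n]) ω + ε n ω z
  memLp_relaxation : ∀ n, MemLp (lam n) ⊤ P
  relaxation_pos : ∀ n, ∀ᵐ ω ∂P, 0 < lam n ω
  iterate_succ : ∀ n, ∀ᵐ ω ∂P,
    x (n + 1) ω = x n ω - lam n ω • (stepCoeff (x n ω) (t n ω) (η n ω) • t n ω)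

/-- The variant in which the tolerances are Carathéodory integrands of the above class and
`lamₙ ∈ L^∞(Ω, σ(x₀, …, xₙ), P; ]0, 2[)`. -/
structure IsBoundedRelaxationSeq [CompleteSpace H] (P : Measure Ω) (Z : Set H)
    (x t : ℕ → Ω → H) (η : ℕ → Ω → ℝ) (ε : ℕ → Ω → H → ℝ) (lam : ℕ → Ω → ℝ) : Prop
    extends IsOuterApproxSeq P Z x t η ε lam where
  tolerance_mem : ∀ n, IsCaratheodoryClass P (ε n)
  relaxation_adapted : ∀ n, AEStronglyMeasurable[pastSigma x n] (lam n) P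
  relaxation_lt_two : ∀ n, ∀ᵐ ω ∂P, lam n ω < 2

end

end StochasticOuterApproximation

end

open MeasureTheory Filter Topology

namespace StochasticOuterApproximation

/-! ### Weak convergence in a separable Hilbert space. -/

section WeakConvergence

variable {H : Type*} [NormedAddCommGroup H] [InnerProductSpace ℝ H] [CompleteSpace H]

/-! Write `d = α t`. Since `⟨x, d⟩ = ‖d‖² + α η`, expanding the square shows that a relaxed step
changes `‖x - z‖²` by `2λ(⟨z, d⟩ - α η) - λ(2 - λ)‖d‖²`. As `λ` is known given the past,
conditioning and the outer approximation inequality yield `E(‖xₙ₊₁ - z‖² | 𝒳ₙ) ≤ ‖xₙ - z‖² + 2 λₙ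
εₙ(z)` (`condExp_norm_sub_sq_le`). A Robbins–Siegmund theorem
(`ae_exists_tendsto_of_condExp_le_add`) then makes `‖xₙ - z‖` converge almost surely for each `z`.
The tolerances are not adapted, so it works with the adapted positive part of the conditional
increment. A countable dense subset of `Z` gives one null set for all `z`, and Opial's lemma
concludes. Under the summability in expectation, the iterates are bounded in `L²`; Fatou's lemma
puts the limit in `L²`, and Vitali's theorem, applied to inner products with a fixed `L²` function,
gives weak convergence there. -/

theorem weaklyConverges_iff_forall_inner {u : ℕ → H} {a : H} :
    WeaklyConverges u a ↔
      ∀ h, Tendsto (fun n => inner ℝ h (u n)) atTop (𝓝 (inner ℝ h a)) := by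
  have key : WeaklyConverges u a ↔
      ∀ f : StrongDual ℝ H, Tendsto (fun n => f (u n)) atTop (𝓝 (f a)) := by
    have hinj : Function.Injective (topDualPairing ℝ H).flip := by
      intro v w hvw
      rw [← sub_eq_zero, ← inner_self_eq_zero (𝕜 := ℝ)]
      have := congrArg (fun g => g (InnerProductSpace.toDual ℝ H (v - w))) hvw
      simp only [LinearMap.flip_apply, topDualPairing_apply,
        InnerProductSpace.toDual_apply_apply] at this
      rw [inner_sub_right, this, sub_self]
    exact WeakBilin.tendsto_iff_forall_eval_tendsto _ hinj
  rw [key]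
  constructor
  · intro h v
    simpa using h (InnerProductSpace.toDual ℝ H v)
  · intro h f
    simpa using h ((InnerProductSpace.toDual ℝ H).symm f)

/-- Bounded sequences of a separable Hilbert space have weakly convergent subsequences. -/
theorem exists_subseq_weaklyConverges [TopologicalSpace.SeparableSpace H] {u : ℕ → H} {R : ℝ}
    (hu : ∀ n, ‖u n‖ ≤ R) :
    ∃ a, ∃ k : ℕ → ℕ, StrictMono k ∧ WeaklyConverges (fun n => u (k n)) a := by
  -- Sequential Banach–Alaoglu, transported through the Riesz isometry.
  obtain ⟨φ, -, k, hk, hφ⟩ := WeakDual.isSeqCompact_closedBall ℝ H 0 R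
    (x := fun n => StrongDual.toWeakDual (InnerProductSpace.toDual ℝ H (u n)))
    (fun n => by
      simpa using! hu n)
  refine ⟨(InnerProductSpace.toDual ℝ H).symm (WeakDual.toStrongDual φ), k, hk, ?_⟩
  rw [weaklyConverges_iff_forall_inner]
  intro h
  have := ((WeakDual.eval_continuous h).tendsto φ).comp hφ
  rw [real_inner_comm, InnerProductSpace.toDual_symm_apply]
  refine this.congr fun n => ?_
  exact real_inner_comm _ _

/-- **Opial's lemma**. -/
theorem exists_weaklyConverges_of_forall_tendsto_dist [TopologicalSpace.SeparableSpace H]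
    {u : ℕ → H} {Z : Set H} (hZ : Z.Nonempty)
    (hdist : ∀ z ∈ Z, ∃ l, Tendsto (fun n => ‖u n - z‖ ^ 2) atTop (𝓝 l))
    (hcluster : weakSeqClusterPts u ⊆ Z) : ∃ a ∈ Z, WeaklyConverges u a := by
  obtain ⟨R, hR⟩ : ∃ R, ∀ n, ‖u n‖ ≤ R := by
    obtain ⟨z, hz⟩ := hZ
    obtain ⟨l, hl⟩ := hdist z hz
    obtain ⟨C, hC⟩ := hl.bddAbove_range
    refine ⟨√C + ‖z‖, fun n => ?_⟩
    have h1 : ‖u n - z‖ ≤ √C := Real.le_sqrt_of_sq_le (hC ⟨n, rfl⟩)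
    have h2 : ‖u n‖ ≤ ‖u n - z‖ + ‖z‖ := by simpa using norm_add_le (u n - z) z
    linarith
  obtain ⟨a, k, hk, ha⟩ := exists_subseq_weaklyConverges hR
  have haZ : a ∈ Z := hcluster ⟨k, hk, ha⟩
  have huniq : ∀ b ∈ weakSeqClusterPts u, b = a := by
    rintro b ⟨j, hj, hb⟩
    obtain ⟨l, hl⟩ := hdist a haZ
    obtain ⟨l', hl'⟩ := hdist b (hcluster ⟨j, hj, hb⟩)
    -- `‖u - a‖² - ‖u - b‖²` is affine in `u`, so the whole sequence `⟨b - a, uₙ⟩` converges and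
    -- takes the same limit along both subsequences; hence `‖b - a‖² = 0`.
    have hlim : Tendsto (fun n => inner ℝ (b - a) (u n)) atTop
        (𝓝 ((l - l' - ‖a‖ ^ 2 + ‖b‖ ^ 2) / 2)) := by
      refine ((((hl.sub hl').sub_const _).add_const _).div_const _).congr fun n => ?_
      rw [norm_sub_sq_real, norm_sub_sq_real, inner_sub_left, real_inner_comm b,
        real_inner_comm a]
      ring
    have h1 := tendsto_nhds_unique (hlim.comp hk.tendsto_atTop)
      (weaklyConverges_iff_forall_inner.1 ha (b - a))
    have h2 := tendsto_nhds_unique (hlim.comp hj.tendsto_atTop)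
      (weaklyConverges_iff_forall_inner.1 hb (b - a))
    rw [← sub_eq_zero, ← inner_self_eq_zero (𝕜 := ℝ), inner_sub_right, ← h1, ← h2, sub_self]
  refine ⟨a, haZ, tendsto_of_subseq_tendsto fun ns hns => ?_⟩
  obtain ⟨φ, hφ, hnsφ⟩ := strictMono_subseq_of_tendsto_atTop hns
  obtain ⟨b, j, hj, hb⟩ := exists_subseq_weaklyConverges (fun n => hR (ns (φ n)))
  refine ⟨fun n => φ (j n), ?_⟩
  have : b = a := huniq b ⟨fun n => ns (φ (j n)), hnsφ.comp hj, hb⟩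
  subst this
  exact hb

/-- A pointwise weak limit of measurable functions is measurable. -/
theorem measurable_of_forall_weaklyConverges [TopologicalSpace.SeparableSpace H]
    [MeasurableSpace H] [BorelSpace H] {Ω : Type*} [MeasurableSpace Ω] {x : ℕ → Ω → H}
    {y : Ω → H} (hx : ∀ n, Measurable (x n))
    (hxy : ∀ ω, WeaklyConverges (fun n => x n ω) (y ω)) : Measurable y := by
  have : SecondCountableTopology H := UniformSpace.secondCountable_of_separable H
  have hinner : ∀ h, Measurable fun ω => inner ℝ h (y ω) := fun h =>
    measurable_of_tendsto_metrizable (fun n => measurable_const.inner (hx n))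
      (tendsto_pi_nhds.2 fun ω => weaklyConverges_iff_forall_inner.1 (hxy ω) h)
  let s := TopologicalSpace.denseSeq H
  -- the distance to a point is a countable supremum of affine functions of inner products
  have hball : ∀ (c : H) (r : ℝ), 0 ≤ r → MeasurableSet {ω | ‖y ω - c‖ ≤ r} := by
    intro c r hr
    have : {ω | ‖y ω - c‖ ≤ r} =
        ⋂ n, {ω | inner ℝ (s n) (y ω) - inner ℝ (s n) c ≤ r * ‖s n‖} := by
      ext ω
      simp only [Set.mem_ofPred_eq, Set.mem_iInter]
      constructor
      · intro h n
        rw [← inner_sub_right]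
        calc _ ≤ ‖s n‖ * ‖y ω - c‖ := real_inner_le_norm _ _
          _ ≤ ‖s n‖ * r := by gcongr
          _ = _ := mul_comm _ _
      · intro h
        have hall : ∀ v : H, inner ℝ v (y ω) - inner ℝ v c ≤ r * ‖v‖ := by
          intro v
          have hcl : IsClosed {v : H | inner ℝ v (y ω) - inner ℝ v c ≤ r * ‖v‖} :=
            isClosed_le (by fun_prop) (by fun_prop)
          have : closure (Set.range s) ⊆ {v : H | inner ℝ v (y ω) - inner ℝ v c ≤ r * ‖v‖} :=
            hcl.closure_subset_iff.2 (by rintro _ ⟨n, rfl⟩; exact h n)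
          exact this (TopologicalSpace.denseRange_denseSeq H v)
        have := hall (y ω - c)
        rw [← inner_sub_right, real_inner_self_eq_norm_sq] at this
        by_contra! hlt
        have : 0 < ‖y ω - c‖ := hr.trans_lt hlt
        nlinarith
    rw [this]
    exact MeasurableSet.iInter fun n =>
      measurableSet_le ((hinner _).sub_const _) measurable_const
  have hdist : ∀ c, Measurable fun ω => dist (y ω) c := by
    intro c
    refine measurable_of_Iic fun r => ?_
    rcases le_or_gt 0 r with hr | hr
    · simpa [Set.preimage, dist_eq_norm] using hball c r hr
    · convert! MeasurableSet.empty
      ext ω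
      simpa using! hr.trans_le dist_nonneg
  -- By separability an open set is a countable union of balls, whose preimages are measurable by
  -- `hdist`.
  refine measurable_of_isOpen fun U hU => ?_
  obtain ⟨T, hT, hTU⟩ : ∃ T : Set (H × ℝ), T.Countable ∧
      U = ⋃ p ∈ T, Metric.ball p.1 p.2 := by
    refine ⟨{p | p ∈ (Set.range s) ×ˢ (Set.range ((↑) : ℚ → ℝ)) ∧ Metric.ball p.1 p.2 ⊆ U},
      ((Set.countable_range s).prod (Set.countable_range _)).mono fun p hp => hp.1, ?_⟩
    ext v
    simp only [Set.mem_iUnion, Set.mem_ofPred_eq, exists_prop]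
    constructor
    · intro hv
      obtain ⟨δ, hδ, hδU⟩ := Metric.isOpen_iff.1 hU v hv
      obtain ⟨q, hq0, hqδ⟩ := exists_rat_btwn (half_pos hδ)
      obtain ⟨n, hn⟩ := (TopologicalSpace.denseRange_denseSeq H).exists_dist_lt v hq0
      refine ⟨(s n, (q : ℝ)), ⟨⟨⟨n, rfl⟩, q, rfl⟩, fun w hw => hδU ?_⟩, hn⟩
      have hw : dist w (s n) < q := hw
      have hn : dist v (s n) < q := hn
      have := dist_triangle_right w v (s n)
      rw [Metric.mem_ball]
      linarith
    · rintro ⟨p, ⟨-, hp⟩, hv⟩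
      exact hp hv
  rw [hTU, Set.preimage_iUnion₂]
  exact MeasurableSet.biUnion hT fun p _ => measurableSet_lt (hdist p.1) measurable_const

end WeakConvergence

/-! ### Almost supermartingales. -/

/-- A nonnegative almost supermartingale whose adapted perturbations have partial sums bounded
by `c` on an event converges almost surely on that event. -/
theorem ae_exists_tendsto_of_condExp_le_add_of_sum_le {Ω : Type*} {mΩ : MeasurableSpace Ω}
    {P : Measure Ω} [IsFiniteMeasure P] {ℱ : Filtration ℕ mΩ} {Y a : ℕ → Ω → ℝ}
    (hY : StronglyAdapted ℱ Y) (ha : StronglyAdapted ℱ a) (hYint : ∀ n, Integrable (Y n) P)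
    (haint : ∀ n, Integrable (a n) P) (hY0 : ∀ n ω, 0 ≤ Y n ω) (ha0 : ∀ n ω, 0 ≤ a n ω)
    (hle : ∀ n, P[Y (n + 1) | ℱ n] ≤ᵐ[P] Y n + a n) {c : ℝ} :
    ∀ᵐ ω ∂P, (∀ n, ∑ k ∈ Finset.range n, a k ω ≤ c) →
      ∃ l, Tendsto (fun n => Y n ω) atTop (𝓝 l) := by
  let S : ℕ → Set Ω := fun n => {ω | ∑ k ∈ Finset.range n, a k ω ≤ c}
  -- The sum defining `S (n + 1)` stops at `a n`, so this event is already known at time `n`.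
  have hSpred : ∀ n, MeasurableSet[ℱ n] (S (n + 1)) := fun n => by
    refine measurableSet_le (Finset.measurable_fun_sum _ fun k hk => ?_) measurable_const
    exact (ha k).measurable.mono (ℱ.mono (Nat.lt_succ_iff.1 (Finset.mem_range.1 hk))) le_rfl
  have hSadp : ∀ n, MeasurableSet[ℱ n] (S n) := fun n => by
    refine measurableSet_le (Finset.measurable_fun_sum _ fun k hk => ?_) measurable_const
    exact (ha k).measurable.mono (ℱ.mono (Finset.mem_range.1 hk).le) le_rfl
  have hSanti : ∀ n, S (n + 1) ⊆ S n := fun n ω hω => by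
    have : ∑ k ∈ Finset.range (n + 1), a k ω ≤ c := hω
    rw [Finset.sum_range_succ] at this
    have := ha0 n ω
    change ∑ k ∈ Finset.range n, a k ω ≤ c
    linarith
  -- `Y` is killed once the sums exceed `c`, which nonnegativity of `Y` makes harmless for the
  -- supermartingale inequality; subtracting the increments incurred before then compensates the
  -- perturbations.
  let U : ℕ → Ω → ℝ := fun n ω =>
    (S n).indicator (Y n) ω - ∑ k ∈ Finset.range n, (S (k + 1)).indicator (a k) ω
  have hUint : ∀ n, Integrable (U n) P := fun n =>
    ((hYint n).indicator (ℱ.le n _ (hSadp n))).sub (integrable_finsetSum _ fun k _ =>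
      (haint k).indicator (ℱ.le k _ (hSpred k)))
  have hUadp : StronglyAdapted ℱ U := fun n =>
    ((hY n).indicator (hSadp n)).sub (Finset.stronglyMeasurable_fun_sum _ fun k hk =>
      ((ha k).indicator (hSpred k)).mono (ℱ.mono (Finset.mem_range.1 hk).le))
  have hUsuper : Supermartingale U ℱ P := by
    refine supermartingale_nat hUadp hUint fun n => ?_
    have hsum_adp : StronglyMeasurable[ℱ n]
        (fun ω => ∑ k ∈ Finset.range (n + 1), (S (k + 1)).indicator (a k) ω) :=
      Finset.stronglyMeasurable_fun_sum _ fun k hk =>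
        ((ha k).indicator (hSpred k)).mono (ℱ.mono (Nat.lt_succ_iff.1 (Finset.mem_range.1 hk)))
    have hsum_int : Integrable
        (fun ω => ∑ k ∈ Finset.range (n + 1), (S (k + 1)).indicator (a k) ω) P :=
      integrable_finsetSum _ fun k _ => (haint k).indicator (ℱ.le k _ (hSpred k))
    have h1 := condExp_sub ((hYint (n + 1)).indicator (ℱ.le n _ (hSpred n))) hsum_int (ℱ n)
    have h2 := condExp_indicator (hYint (n + 1)) (hSpred n)
    have h3 := condExp_of_stronglyMeasurable (ℱ.le n) hsum_adp hsum_int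
    filter_upwards [h1, h2, hle n] with ω h1 h2 hle
    change (P[(S (n + 1)).indicator (Y (n + 1)) -
      (fun ω => ∑ k ∈ Finset.range (n + 1), (S (k + 1)).indicator (a k) ω) | ℱ n]) ω ≤ U n ω
    rw [h1, Pi.sub_apply, h2, h3]
    simp only [U, Finset.sum_range_succ]
    by_cases hω : ω ∈ S (n + 1)
    · have hω' := hSanti n hω
      simp only [Set.indicator_of_mem hω, Set.indicator_of_mem hω', Pi.add_apply] at hle ⊢
      linarith
    · simp only [Set.indicator_of_notMem hω]
      have : 0 ≤ (S n).indicator (Y n) ω := Set.indicator_nonneg (fun ω _ => hY0 n ω) ω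
      linarith
  -- The maximum covers `c < 0`, where even the empty sum exceeds `c`.
  have hsum_le : ∀ n ω, ∑ k ∈ Finset.range n, (S (k + 1)).indicator (a k) ω ≤ max c 0 := by
    intro n ω
    induction n with
    | zero => simp
    | succ n ih =>
      by_cases hω : ω ∈ S (n + 1)
      · refine le_trans (Finset.sum_le_sum fun k _ => ?_) (le_trans hω (le_max_left _ _))
        exact Set.indicator_le_self' (fun ω _ => ha0 k ω) ω
      · rw [Finset.sum_range_succ, Set.indicator_of_notMem hω, add_zero]
        exact ih
  have hUlb : ∀ n ω, -max c 0 ≤ U n ω := fun n ω => by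
    have : 0 ≤ (S n).indicator (Y n) ω := Set.indicator_nonneg (fun ω _ => hY0 n ω) ω
    have := hsum_le n ω
    simp only [U]
    linarith
  -- A lower bound and nonincreasing expectations suffice: `U ≥ -m` gives `|U| ≤ U + 2m`.
  have hUbdd : ∀ n, eLpNorm ((-U) n) 1 P ≤
      (Real.toNNReal (∫ ω, U 0 ω + 2 * max c 0 ∂P) : ENNReal) := by
    intro n
    rw [Pi.neg_apply, eLpNorm_neg, eLpNorm_one_eq_lintegral_enorm,
      ← ofReal_integral_norm_eq_lintegral_enorm (hUint n)]
    refine ENNReal.ofReal_le_ofReal ?_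
    have hint0 : ∫ ω, U n ω ∂P ≤ ∫ ω, U 0 ω ∂P := by
      simpa using hUsuper.setIntegral_le (Nat.zero_le n) MeasurableSet.univ
    calc ∫ ω, ‖U n ω‖ ∂P ≤ ∫ ω, U n ω + 2 * max c 0 ∂P := by
          refine integral_mono (hUint n).norm ((hUint n).add (integrable_const _)) fun ω => ?_
          have := hUlb n ω
          have := le_max_right c 0
          change |U n ω| ≤ U n ω + 2 * max c 0
          rw [abs_le]
          constructor <;> linarith
      _ ≤ ∫ ω, U 0 ω + 2 * max c 0 ∂P := by
          rw [integral_add (hUint n) (integrable_const _),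
            integral_add (hUint 0) (integrable_const _)]
          linarith
  filter_upwards [hUsuper.neg.ae_tendsto_limitProcess hUbdd] with ω hω hc
  have hmem : ∀ n, ω ∈ S n := hc
  have hsum : Summable fun k => a k ω := summable_of_sum_range_le (fun k => ha0 k ω) hc
  refine ⟨_, (hω.neg.add hsum.hasSum.tendsto_sum_nat).congr fun n => ?_⟩
  simp [U, Set.indicator_of_mem (hmem _)]

/-- **Robbins–Siegmund theorem** with perturbations that need not be adapted. -/
theorem ae_exists_tendsto_of_condExp_le_add {Ω : Type*} {mΩ : MeasurableSpace Ω}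
    {P : Measure Ω} [IsFiniteMeasure P] {ℱ : Filtration ℕ mΩ} {Y e : ℕ → Ω → ℝ}
    (hY : StronglyAdapted ℱ Y) (hYint : ∀ n, Integrable (Y n) P) (hY0 : ∀ n ω, 0 ≤ Y n ω)
    (he0 : ∀ n, ∀ᵐ ω ∂P, 0 ≤ e n ω) (hle : ∀ n, P[Y (n + 1) | ℱ n] ≤ᵐ[P] Y n + e n)
    (he : ∀ᵐ ω ∂P, Summable fun n => e n ω) :
    ∀ᵐ ω ∂P, ∃ l, Tendsto (fun n => Y n ω) atTop (𝓝 l) := by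
  let a : ℕ → Ω → ℝ := fun n ω => max ((P[Y (n + 1) | ℱ n]) ω - Y n ω) 0
  have ha : StronglyAdapted ℱ a := fun n => by
    have h : StronglyMeasurable[ℱ n] fun ω => (P[Y (n + 1) | ℱ n]) ω - Y n ω :=
      stronglyMeasurable_condExp.sub (hY n)
    exact (measurable_id.max measurable_const).stronglyMeasurable.comp_measurable h.measurable
  have haint : ∀ n, Integrable (a n) P := fun n => (integrable_condExp.sub (hYint n)).pos_part
  have hconv : ∀ c : ℕ, ∀ᵐ ω ∂P, (∀ n, ∑ k ∈ Finset.range n, a k ω ≤ c) →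
      ∃ l, Tendsto (fun n => Y n ω) atTop (𝓝 l) := fun c =>
    ae_exists_tendsto_of_condExp_le_add_of_sum_le hY ha hYint haint hY0
      (fun n ω => le_max_right _ _) fun n => .of_forall fun ω => by
        have := le_max_left ((P[Y (n + 1) | ℱ n]) ω - Y n ω) 0
        simp only [Pi.add_apply, a]
        linarith
  filter_upwards [ae_all_iff.2 hconv, ae_all_iff.2 hle, ae_all_iff.2 he0, he] with ω h1 h2 h3 h4
  have hae : ∀ k, a k ω ≤ e k ω := fun k =>
    max_le (by have := h2 k; simp only [Pi.add_apply] at this; linarith) (h3 k)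
  -- Integer levels `c` exhaust the event of summability while keeping the exceptional sets
  -- countable.
  obtain ⟨c, hc⟩ := exists_nat_ge (∑' n, e n ω)
  refine h1 c fun n => le_trans (Finset.sum_le_sum fun k _ => hae k) (le_trans ?_ hc)
  exact h4.sum_le_tsum _ fun k _ => h3 k

/-! ### From almost sure weak convergence to weak convergence in `L²`. -/

section WeakConvergenceLp

variable {H : Type*} [NormedAddCommGroup H] [InnerProductSpace ℝ H] [CompleteSpace H]

/-- `2⟨a, uₙ⟩ - ‖a‖²` tends to `‖a‖²` and never exceeds `‖uₙ‖²`. The extended nonnegative form is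
the one Fatou's lemma takes. -/
theorem ofReal_norm_sq_le_liminf_of_weaklyConverges {u : ℕ → H} {a : H}
    (h : WeaklyConverges u a) :
    ENNReal.ofReal (‖a‖ ^ 2) ≤ liminf (fun n => ENNReal.ofReal (‖u n‖ ^ 2)) atTop := by
  have h1 : Tendsto (fun n => ENNReal.ofReal (2 * inner ℝ a (u n) - ‖a‖ ^ 2)) atTop
      (𝓝 (ENNReal.ofReal (‖a‖ ^ 2))) := by
    have := ((weaklyConverges_iff_forall_inner.1 h a).const_mul 2).sub_const (‖a‖ ^ 2)
    rw [real_inner_self_eq_norm_sq, two_mul, add_sub_cancel_right] at this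
    exact ENNReal.tendsto_ofReal this
  rw [← h1.liminf_eq]
  refine liminf_le_liminf (.of_forall fun n => ENNReal.ofReal_le_ofReal ?_)
  have h2 := sq_nonneg ‖u n - a‖
  rw [norm_sub_sq_real, real_inner_comm] at h2
  linarith

variable {Ω : Type*} [MeasurableSpace Ω] {P : Measure Ω} {x : ℕ → Ω → H} {y : Ω → H} {C : ℝ}

/-- Almost sure weak limits of sequences bounded in `L²` are in `L²`. -/
theorem memLp_two_of_ae_weaklyConverges (hx : ∀ n, MemLp (x n) 2 P)
    (hC : ∀ n, ∫ ω, ‖x n ω‖ ^ 2 ∂P ≤ C) (hy : AEStronglyMeasurable y P)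
    (hw : ∀ᵐ ω ∂P, WeaklyConverges (fun n => x n ω) (y ω)) : MemLp y 2 P := by
  rw [memLp_two_iff_integrable_sq_norm hy]
  refine ⟨(hy.norm.pow 2), ?_⟩
  rw [hasFiniteIntegral_iff_ofReal (.of_forall fun ω => sq_nonneg _)]
  calc ∫⁻ ω, ENNReal.ofReal (‖y ω‖ ^ 2) ∂P
      ≤ ∫⁻ ω, liminf (fun n => ENNReal.ofReal (‖x n ω‖ ^ 2)) atTop ∂P :=
        lintegral_mono_ae (hw.mono fun ω h => ofReal_norm_sq_le_liminf_of_weaklyConverges h)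
    _ ≤ liminf (fun n => ∫⁻ ω, ENNReal.ofReal (‖x n ω‖ ^ 2) ∂P) atTop :=
        lintegral_liminf_le' fun n => ((hx n).1.norm.pow 2).aemeasurable.ennreal_ofReal
    _ ≤ liminf (fun _ : ℕ => ENNReal.ofReal C) atTop := by
        refine liminf_le_liminf (.of_forall fun n => ?_)
        have hint := (memLp_two_iff_integrable_sq_norm (hx n).1).1 (hx n)
        rw [← ofReal_integral_eq_lintegral_ofReal hint (.of_forall fun ω => sq_nonneg _)]
        exact ENNReal.ofReal_le_ofReal (hC n)
    _ < ⊤ := by simp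

/-- Almost sure weak convergence of a sequence bounded in `L²` implies weak convergence
in `L²`. -/
theorem weaklyConverges_toLp_of_ae [IsFiniteMeasure P] (hx : ∀ n, MemLp (x n) 2 P)
    (hC : ∀ n, ∫ ω, ‖x n ω‖ ^ 2 ∂P ≤ C) (hy : MemLp y 2 P)
    (hw : ∀ᵐ ω ∂P, WeaklyConverges (fun n => x n ω) (y ω)) :
    WeaklyConverges (fun n => (hx n).toLp (x n)) (hy.toLp y) := by
  rw [weaklyConverges_iff_forall_inner]
  intro g
  have hg := Lp.memLp g
  have hinner : ∀ {v : Ω → H} (hv : MemLp v 2 P),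
      inner ℝ g (hv.toLp v) = ∫ ω, inner ℝ (g ω) (v ω) ∂P := fun {v} hv => by
    rw [L2.inner_def]
    refine integral_congr_ae ?_
    filter_upwards [hv.coeFn_toLp] with ω h
    rw [h]
  have hint : ∀ {v : Ω → H}, MemLp v 2 P → Integrable (fun ω => inner ℝ (g ω) (v ω)) P :=
    fun {v} hv => (hg.norm.integrable_mul hv.norm).mono' (hg.1.inner hv.1)
      (.of_forall fun ω => norm_inner_le_norm (g ω) (v ω))
  have hnorm : ∀ n, eLpNorm (x n) 2 P ≤ ENNReal.ofReal √C := fun n => by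
    rw [(hx n).eLpNorm_eq_integral_rpow_norm (by norm_num) (by norm_num)]
    refine ENNReal.ofReal_le_ofReal ?_
    rw [Real.sqrt_eq_rpow]
    simp only [ENNReal.toReal_ofNat, Real.rpow_two, ← one_div]
    exact Real.rpow_le_rpow (integral_nonneg fun ω => sq_nonneg _) (hC n) (by norm_num)
  -- By Hölder, the `L¹` norm over `s` is at most `‖1ₛ g‖₂ √C`, small uniformly in `n` when `P s` is
  -- small. Dividing by `√C + 1` avoids a zero denominator.
  have hui : UnifIntegrable (fun n ω => inner ℝ (g ω) (x n ω)) 1 P := by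
    intro δ hδ
    obtain ⟨ρ, hρ, h⟩ := hg.eLpNorm_indicator_le (by norm_num) (by norm_num)
      (div_pos hδ (by positivity : 0 < √C + 1))
    refine ⟨ρ, hρ, fun n s hs hPs => ?_⟩
    have hle : eLpNorm (s.indicator fun ω => inner ℝ (g ω) (x n ω)) 1 P ≤
        eLpNorm ((fun ω => ‖s.indicator g ω‖) • fun ω => ‖x n ω‖) 1 P := by
      refine eLpNorm_mono fun ω => ?_
      by_cases hω : ω ∈ s
      · simpa [Set.indicator_of_mem hω] using abs_real_inner_le_norm (g ω) (x n ω)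
      · simp [Set.indicator_of_notMem hω]
    have hholder := eLpNorm_smul_le_mul_eLpNorm (μ := P) (p := 2) (q := 2) (r := 1)
      (hx n).1.norm ((hg.indicator hs).1.norm)
    rw [eLpNorm_norm, eLpNorm_norm] at hholder
    calc _ ≤ _ := hle
      _ ≤ _ := hholder
      _ ≤ ENNReal.ofReal (δ / (√C + 1)) * ENNReal.ofReal √C := mul_le_mul' (h s hs hPs) (hnorm n)
      _ = ENNReal.ofReal (δ / (√C + 1) * √C) := (ENNReal.ofReal_mul (by positivity)).symm
      _ ≤ ENNReal.ofReal δ := by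
        refine ENNReal.ofReal_le_ofReal ?_
        rw [div_mul_eq_mul_div, div_le_iff₀ (by positivity)]
        nlinarith
  simp_rw [hinner]
  refine tendsto_integral_of_L1' _ (hint hy).1 (.of_forall fun n => hint (hx n)) ?_
  exact tendsto_Lp_finite_of_tendsto_ae le_rfl (by norm_num) (fun n => (hint (hx n)).1)
    (memLp_one_iff_integrable.2 (hint hy)) hui
    (hw.mono fun ω h => weaklyConverges_iff_forall_inner.1 h (g ω))

end WeakConvergenceLp

/-! ### Pointwise geometry of one step. -/

section StepCoeff

variable {H : Type*} [NormedAddCommGroup H] [InnerProductSpace ℝ H]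

/-- When the step `d` is active, `x - d` is the projection of `x` onto the hyperplane `⟨·, t⟩ = η`,
so `⟨x - d, d⟩ = α η`. -/
theorem inner_stepCoeff_smul (x t : H) (η : ℝ) :
    inner ℝ x (stepCoeff x t η • t) = ‖stepCoeff x t η • t‖ ^ 2 + stepCoeff x t η * η := by
  rw [norm_smul, mul_pow, inner_smul_right, Real.norm_eq_abs, sq_abs]
  unfold stepCoeff
  split_ifs with h
  · have : ‖t‖ ≠ 0 := norm_ne_zero_iff.2 h.1
    field_simp
    ring
  · simp

/-- An active step has length `⟨x, t⟩/‖t‖ - η/‖t‖`. This bound puts the step in `L²` with no control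
on the coefficient itself. -/
theorem norm_stepCoeff_smul_le (x t : H) (η : ℝ) :
    ‖stepCoeff x t η • t‖ ≤ ‖x‖ + ‖activeLevel x t η‖ := by
  unfold stepCoeff activeLevel
  split_ifs with h
  · have ht : 0 < ‖t‖ := norm_pos_iff.2 h.1
    have h1 : ‖((inner ℝ x t - η) / ‖t‖ ^ 2) • t‖ = inner ℝ x t / ‖t‖ - η / ‖t‖ := by
      rw [norm_smul, Real.norm_of_nonneg (div_nonneg (sub_nonneg.2 h.2.le) (sq_nonneg _))]
      field_simp
    have h2 : inner ℝ x t / ‖t‖ ≤ ‖x‖ := (div_le_iff₀ ht).2 (real_inner_le_norm x t)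
    have h3 := neg_abs_le (η / ‖t‖)
    rw [h1, Real.norm_eq_abs]
    linarith
  · simp

/-- Exhibits `α η` as a product of two `L²` functions, hence integrable. -/
theorem stepCoeff_mul_level (x t : H) (η : ℝ) :
    stepCoeff x t η * η = ‖stepCoeff x t η • t‖ * activeLevel x t η := by
  unfold stepCoeff activeLevel
  split_ifs with h
  · have ht : 0 < ‖t‖ := norm_pos_iff.2 h.1
    rw [norm_smul, Real.norm_of_nonneg (div_nonneg (sub_nonneg.2 h.2.le) (sq_nonneg _))]
    field_simp
  · simp

theorem measurable_stepCoeff [MeasurableSpace H] [BorelSpace H] [SecondCountableTopology H] :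
    Measurable fun p : H × H × ℝ => stepCoeff p.1 p.2.1 p.2.2 := by
  classical
  have hinner : Measurable fun p : H × H × ℝ => inner ℝ p.1 p.2.1 :=
    measurable_fst.inner measurable_snd.fst
  unfold stepCoeff
  refine Measurable.ite (MeasurableSet.inter ?_ ?_) ?_ measurable_const
  · exact (measurableSet_eq_fun measurable_snd.fst measurable_const).compl
  · exact measurableSet_lt measurable_snd.snd hinner
  · exact (hinner.sub measurable_snd.snd).div (measurable_snd.fst.norm.pow_const 2)

/-- The squared distance to `z` after a relaxed step, in terms of the one before it. -/
theorem norm_sq_relaxed_step_le (x t z : H) (η : ℝ) {l : ℝ} (h0 : 0 ≤ l) (h2 : l ≤ 2) :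
    ‖x - l • (stepCoeff x t η • t) - z‖ ^ 2 ≤ ‖x - z‖ ^ 2 +
      2 * (l * (inner ℝ z (stepCoeff x t η • t) - stepCoeff x t η * η)) := by
  have h := inner_stepCoeff_smul x t η
  generalize stepCoeff x t η * η = b at h ⊢
  generalize stepCoeff x t η • t = d at h ⊢
  have hsplit : x - l • d - z = (x - z) - l • d := by abel
  rw [hsplit, norm_sub_sq_real, inner_smul_right, inner_sub_left, h, norm_smul, mul_pow,
    Real.norm_eq_abs, sq_abs]
  -- The discarded term is `-l (2 - l) ‖d‖²`.
  nlinarith [mul_nonneg (mul_nonneg h0 (sub_nonneg.2 h2)) (sq_nonneg ‖d‖)]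

end StepCoeff

theorem measurable_pastSigma {Ω H : Type*} [MeasurableSpace H] (x : ℕ → Ω → H) (n : ℕ) :
    Measurable[pastSigma x n] (x n) :=
  (comap_measurable (x n)).mono
    (le_iSup₂_of_le (f := fun k (_ : k ≤ n) => MeasurableSpace.comap (x k) inferInstance)
      n le_rfl le_rfl) le_rfl

theorem stronglyMeasurable_pastSigma_norm_sub_sq {Ω H : Type*} [NormedAddCommGroup H]
    [SecondCountableTopology H] [MeasurableSpace H] [BorelSpace H] (x : ℕ → Ω → H) (z : H)
    (n : ℕ) : StronglyMeasurable[pastSigma x n] fun ω => ‖x n ω - z‖ ^ 2 :=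
  Measurable.stronglyMeasurable <|
    ((measurable_id.sub_const z).norm.pow_const 2).comp (measurable_pastSigma x n)

theorem integrable_mul_of_memLp_top {Ω : Type*} [MeasurableSpace Ω] {P : Measure Ω}
    {l f : Ω → ℝ} (hl : MemLp l ⊤ P) (hf : Integrable f P) : Integrable (l * f) P := by
  rw [← memLp_one_iff_integrable] at hf ⊢
  exact hf.mul hl

/-! ### Integrability and quasi-Fejér estimates for the algorithm. -/

section Algorithm

variable {H : Type*} [NormedAddCommGroup H] [InnerProductSpace ℝ H] [CompleteSpace H]
  [TopologicalSpace.SeparableSpace H] [MeasurableSpace H] [BorelSpace H]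
  {Ω : Type*} [mΩ : MeasurableSpace Ω] {P : Measure Ω} {Z : Set H} {x t : ℕ → Ω → H}
  {η : ℕ → Ω → ℝ} {ε : ℕ → Ω → H → ℝ} {lam : ℕ → Ω → ℝ}

/-- The filtration generated by a sequence of measurable functions. -/
def pastFiltration (x : ℕ → Ω → H) (hx : ∀ n, Measurable (x n)) : Filtration ℕ mΩ where
  seq := pastSigma x
  mono' := fun _ _ hmn => biSup_mono fun _ hk => hk.trans hmn
  le' := fun _ => iSup₂_le fun k _ => (hx k).comap_le

theorem IsOuterApproxSeq.aestronglyMeasurable_step (hx : IsOuterApproxSeq P Z x t η ε lam)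
    (n : ℕ) : AEStronglyMeasurable
      (fun ω => stepCoeff (x n ω) (t n ω) (η n ω) • t n ω) P := by
  have : SecondCountableTopology H := UniformSpace.secondCountable_of_separable H
  have hcoeff : AEMeasurable (fun ω => stepCoeff (x n ω) (t n ω) (η n ω)) P :=
    measurable_stepCoeff.comp_aemeasurable ((hx.measurable_iterate n).aemeasurable.prodMk
      ((hx.memLp_normal n).1.aemeasurable.prodMk (hx.integrable_level n).1.aemeasurable))
  exact hcoeff.aestronglyMeasurable.smul (hx.memLp_normal n).1

theorem IsOuterApproxSeq.memLp_step (hx : IsOuterApproxSeq P Z x t η ε lam) {n : ℕ}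
    (hn : MemLp (x n) 2 P) :
    MemLp (fun ω => stepCoeff (x n ω) (t n ω) (η n ω) • t n ω) 2 P :=
  (hn.norm.add (hx.memLp_activeLevel n).norm).mono' (hx.aestronglyMeasurable_step n)
    (.of_forall fun _ => norm_stepCoeff_smul_le _ _ _)

theorem IsOuterApproxSeq.memLp_iterate (hx : IsOuterApproxSeq P Z x t η ε lam) (n : ℕ) :
    MemLp (x n) 2 P := by
  induction n with
  | zero => exact hx.memLp_zero
  | succ n ih =>
    have h : MemLp (lam n • fun ω => stepCoeff (x n ω) (t n ω) (η n ω) • t n ω) 2 P :=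
      (hx.memLp_step ih).smul (hx.memLp_relaxation n)
    refine (ih.sub h).ae_eq ?_
    filter_upwards [hx.iterate_succ n] with ω hω
    rw [hω]
    rfl

theorem IsOuterApproxSeq.integrable_stepCoeff_mul_level
    (hx : IsOuterApproxSeq P Z x t η ε lam) (n : ℕ) :
    Integrable (fun ω => stepCoeff (x n ω) (t n ω) (η n ω) * η n ω) P := by
  simp_rw [stepCoeff_mul_level]
  exact (hx.memLp_step (hx.memLp_iterate n)).norm.integrable_mul (hx.memLp_activeLevel n)

theorem IsOuterApproxSeq.integrable_norm_sub_sq [IsFiniteMeasure P]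
    (hx : IsOuterApproxSeq P Z x t η ε lam) (z : H) (n : ℕ) :
    Integrable (fun ω => ‖x n ω - z‖ ^ 2) P :=
  let h := (hx.memLp_iterate n).sub (memLp_const z)
  (memLp_two_iff_integrable_sq_norm h.1).1 h

/-- Conditioning the pointwise estimate lets `lam n` factor out and `⟨z, ·⟩` commute with the
expectation; what remains is `outer_approx` multiplied by `lam n`. -/
theorem IsBoundedRelaxationSeq.condExp_norm_sub_sq_le [IsProbabilityMeasure P]
    (hx : IsBoundedRelaxationSeq P Z x t η ε lam) {z : H} (hz : z ∈ Z) (n : ℕ) :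
    P[fun ω => ‖x (n + 1) ω - z‖ ^ 2 | pastSigma x n] ≤ᵐ[P]
      (fun ω => ‖x n ω - z‖ ^ 2) + fun ω => 2 * (lam n ω * ε n ω z) := by
  have : SecondCountableTopology H := UniformSpace.secondCountable_of_separable H
  have hm : pastSigma x n ≤ mΩ := (pastFiltration x hx.measurable_iterate).le n
  let d : Ω → H := fun ω => stepCoeff (x n ω) (t n ω) (η n ω) • t n ω
  let b : Ω → ℝ := fun ω => stepCoeff (x n ω) (t n ω) (η n ω) * η n ω
  let Y : Ω → ℝ := fun ω => ‖x n ω - z‖ ^ 2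
  let g : Ω → ℝ := (fun ω => inner ℝ z (d ω)) - b
  have hd : Integrable d P := (hx.memLp_step (hx.memLp_iterate n)).integrable (by norm_num)
  have hb : Integrable b P := hx.integrable_stepCoeff_mul_level n
  have hzd : Integrable (fun ω => inner ℝ z (d ω)) P := hd.const_inner z
  have hg : Integrable g P := hzd.sub hb
  have hlg : Integrable (lam n * g) P := integrable_mul_of_memLp_top (hx.memLp_relaxation n) hg
  have hY : Integrable Y P := hx.integrable_norm_sub_sq z n
  have hYm : StronglyMeasurable[pastSigma x n] Y :=
    stronglyMeasurable_pastSigma_norm_sub_sq x z n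
  have hpt : (fun ω => ‖x (n + 1) ω - z‖ ^ 2) ≤ᵐ[P] Y + (2 : ℝ) • (lam n * g) := by
    filter_upwards [hx.iterate_succ n, hx.relaxation_pos n, hx.relaxation_lt_two n]
      with ω h1 h2 h3
    rw [h1]
    exact norm_sq_relaxed_step_le _ _ _ _ h2.le h3.le
  filter_upwards [condExp_mono (m := pastSigma x n) (hx.integrable_norm_sub_sq z (n + 1))
      (hY.add (hlg.smul (2 : ℝ))) hpt,
    condExp_add hY (hlg.smul (2 : ℝ)) (pastSigma x n),
    condExp_smul (2 : ℝ) (lam n * g) (pastSigma x n) (μ := P),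
    condExp_mul_of_aestronglyMeasurable_left (hx.relaxation_adapted n) hlg hg,
    condExp_sub hzd hb (pastSigma x n),
    (innerSL ℝ z).comp_condExp_comm (m := pastSigma x n) hd,
    hx.outer_approx n z hz, hx.relaxation_pos n] with ω h1 h2 h3 h4 h5 h6 h7 h8
  have hYω : (P[Y | pastSigma x n]) ω = Y ω := by
    rw [condExp_of_stronglyMeasurable hm hYm hY]
  have h6' : inner ℝ z ((P[d | pastSigma x n]) ω) =
      (P[fun ω => inner ℝ z (d ω) | pastSigma x n]) ω := h6
  rw [h2, Pi.add_apply, h3, Pi.smul_apply, h4, Pi.mul_apply, h5, Pi.sub_apply, ← h6', hYω] at h1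
  simp only [Pi.add_apply, smul_eq_mul] at h1 ⊢
  have h9 : inner ℝ z ((P[d | pastSigma x n]) ω) - (P[b | pastSigma x n]) ω ≤ ε n ω z :=
    sub_le_iff_le_add'.2 h7
  have h10 := mul_le_mul_of_nonneg_left h9 h8.le
  simp only [Y] at h1
  linarith

theorem IsBoundedRelaxationSeq.ae_exists_tendsto_norm_sub_sq [IsProbabilityMeasure P]
    (hx : IsBoundedRelaxationSeq P Z x t η ε lam) {z : H} (hz : z ∈ Z)
    (hsum : ∀ᵐ ω ∂P, Summable fun n => lam n ω * ε n ω z) :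
    ∀ᵐ ω ∂P, ∃ l, Tendsto (fun n => ‖x n ω - z‖ ^ 2) atTop (𝓝 l) := by
  have : SecondCountableTopology H := UniformSpace.secondCountable_of_separable H
  refine ae_exists_tendsto_of_condExp_le_add (ℱ := pastFiltration x hx.measurable_iterate)
    (e := fun n ω => 2 * (lam n ω * ε n ω z))
    (stronglyMeasurable_pastSigma_norm_sub_sq x z) (hx.integrable_norm_sub_sq z)
    (fun n ω => sq_nonneg _) (fun n => ?_) (hx.condExp_norm_sub_sq_le hz) ?_
  · filter_upwards [hx.relaxation_pos n, hx.tolerance_nonneg n z hz] with ω h1 h2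
    positivity
  · filter_upwards [hsum] with ω h using h.mul_left 2

/-- Taking expectations removes the conditioning, and the resulting recursion telescopes. The
constant comes from `‖x‖² ≤ 2‖x - z‖² + 2‖z‖²`. -/
theorem IsBoundedRelaxationSeq.exists_integral_norm_sq_le [IsProbabilityMeasure P]
    (hx : IsBoundedRelaxationSeq P Z x t η ε lam) {z : H} (hz : z ∈ Z)
    (hsum : Summable fun n => ∫ ω, lam n ω * ε n ω z ∂P) :
    ∃ C, ∀ n, ∫ ω, ‖x n ω‖ ^ 2 ∂P ≤ C := by
  have hstep : ∀ n, ∫ ω, ‖x (n + 1) ω - z‖ ^ 2 ∂P ≤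
      ∫ ω, ‖x n ω - z‖ ^ 2 ∂P + 2 * ∫ ω, lam n ω * ε n ω z ∂P := fun n => by
    have hm : pastSigma x n ≤ mΩ := (pastFiltration x hx.measurable_iterate).le n
    have hint : Integrable (fun ω => lam n ω * ε n ω z) P :=
      integrable_mul_of_memLp_top (hx.memLp_relaxation n) (hx.integrable_tolerance n z hz)
    have hY := hx.integrable_norm_sub_sq z n
    rw [← integral_condExp hm, ← integral_const_mul, ← integral_add hY (hint.const_mul 2)]
    exact integral_mono_ae integrable_condExp (hY.add (hint.const_mul 2))
      (hx.condExp_norm_sub_sq_le hz n)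
  have hnonneg : ∀ n, 0 ≤ ∫ ω, lam n ω * ε n ω z ∂P := fun n => by
    refine integral_nonneg_of_ae ?_
    filter_upwards [hx.relaxation_pos n, hx.tolerance_nonneg n z hz] with ω h1 h2
    exact mul_nonneg h1.le h2
  have hbound : ∀ n, ∫ ω, ‖x n ω - z‖ ^ 2 ∂P ≤ ∫ ω, ‖x 0 ω - z‖ ^ 2 ∂P +
      2 * ∑ k ∈ Finset.range n, ∫ ω, lam k ω * ε k ω z ∂P := fun n => by
    induction n with
    | zero => simp
    | succ n ih =>
      rw [Finset.sum_range_succ]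
      linarith [hstep n]
  refine ⟨2 * (∫ ω, ‖x 0 ω - z‖ ^ 2 ∂P + 2 * ∑' k, ∫ ω, lam k ω * ε k ω z ∂P) + 2 * ‖z‖ ^ 2,
    fun n => ?_⟩
  have hle : ∫ ω, ‖x n ω‖ ^ 2 ∂P ≤ ∫ ω, (2 * ‖x n ω - z‖ ^ 2 + 2 * ‖z‖ ^ 2) ∂P := by
    refine integral_mono ((memLp_two_iff_integrable_sq_norm (hx.memLp_iterate n).1).1
      (hx.memLp_iterate n)) (((hx.integrable_norm_sub_sq z n).const_mul 2).add
        (integrable_const _)) fun ω => ?_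
    have h1 : ‖x n ω‖ ≤ ‖x n ω - z‖ + ‖z‖ := by simpa using norm_add_le (x n ω - z) z
    have h2 := norm_nonneg (x n ω)
    change ‖x n ω‖ ^ 2 ≤ 2 * ‖x n ω - z‖ ^ 2 + 2 * ‖z‖ ^ 2
    nlinarith [sq_nonneg (‖x n ω - z‖ - ‖z‖)]
  rw [integral_add ((hx.integrable_norm_sub_sq z n).const_mul 2) (integrable_const _),
    integral_const_mul, integral_const, probReal_univ, one_smul] at hle
  have := hsum.sum_le_tsum (Finset.range n) fun k _ => hnonneg k
  linarith [hbound n]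

/-- If the distances from a sequence to the points of a dense subset converge, so do
the distances to all points. -/
theorem exists_tendsto_norm_sub_sq_of_denseRange {E ι : Type*} [NormedAddCommGroup E]
    {S : Set E} {s : ι → S} (hs : DenseRange s) {u : ℕ → E}
    (h : ∀ i, ∃ l, Tendsto (fun n => ‖u n - s i‖ ^ 2) atTop (𝓝 l)) {z : E} (hz : z ∈ S) :
    ∃ l, Tendsto (fun n => ‖u n - z‖ ^ 2) atTop (𝓝 l) := by
  have hnorm : ∀ i, CauchySeq fun n => ‖u n - s i‖ := fun i => by
    obtain ⟨l, hl⟩ := h i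
    exact ((Real.continuous_sqrt.tendsto l).comp hl |>.congr fun n => by simp).cauchySeq
  suffices CauchySeq fun n => ‖u n - z‖ by
    obtain ⟨l, hl⟩ := cauchySeq_tendsto_of_complete this
    exact ⟨l ^ 2, hl.pow 2⟩
  rw [Metric.cauchySeq_iff]
  intro δ hδ
  obtain ⟨i, hi⟩ := hs.exists_dist_lt (⟨z, hz⟩ : S) (by positivity : 0 < δ / 3)
  obtain ⟨N, hN⟩ := Metric.cauchySeq_iff.1 (hnorm i) (δ / 3) (by positivity)
  refine ⟨N, fun m hm n hn => ?_⟩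
  have hi : ‖z - s i‖ < δ / 3 := by simpa [Subtype.dist_eq, dist_eq_norm] using hi
  -- The error of replacing `z` by `s i` is uniform in `k`.
  have hclose : ∀ k, |‖u k - z‖ - ‖u k - s i‖| < δ / 3 := fun k => by
    refine (abs_norm_sub_norm_le _ _).trans_lt ?_
    rwa [sub_sub_sub_cancel_left, norm_sub_rev]
  have h1 := abs_lt.1 (hclose m)
  have h2 := abs_lt.1 (hclose n)
  have h3 := hN m hm n hn
  rw [Real.dist_eq, abs_lt] at h3 ⊢
  constructor <;> linarith [h1.1, h1.2, h2.1, h2.2, h3.1, h3.2]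

end Algorithm

end StochasticOuterApproximation

/-! ### Assembly of the convergence theorem. -/

theorem theorem3p8 {H : Type*} [NormedAddCommGroup H] [InnerProductSpace ℝ H] [CompleteSpace H]
    [TopologicalSpace.SeparableSpace H] [MeasurableSpace H] [BorelSpace H]
    {Ω : Type*} [MeasurableSpace Ω] (P : Measure Ω) [IsProbabilityMeasure P] [P.IsComplete]
    (Z : Set H) (hZ_nonempty : Z.Nonempty) (hZ_closed : IsClosed Z)
    (x t : ℕ → Ω → H) (η : ℕ → Ω → ℝ) (ε : ℕ → Ω → H → ℝ) (lam : ℕ → Ω → ℝ)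
    (hx : StochasticOuterApproximation.IsBoundedRelaxationSeq P Z x t η ε lam)
    (hsum : ∀ z ∈ Z, ∀ᵐ ω ∂P, Summable fun n => lam n ω * ε n ω z)
    (hcluster : ∀ᵐ ω ∂P,
      StochasticOuterApproximation.weakSeqClusterPts (fun n => x n ω) ⊆ Z) :
    ∃ xlim : Ω → H, Measurable xlim ∧ (∀ ω, xlim ω ∈ Z) ∧
      (∀ᵐ ω ∂P, StochasticOuterApproximation.WeaklyConverges (fun n => x n ω) (xlim ω)) ∧
      ((∀ z ∈ Z, Summable fun n => ∫ ω, lam n ω * ε n ω z ∂P) →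
        ∃ (hL2 : ∀ n, MemLp (x n) 2 P) (hlim : MemLp xlim 2 P),
          StochasticOuterApproximation.WeaklyConverges
            (fun n => (hL2 n).toLp (x n)) (hlim.toLp xlim)) := by
  open StochasticOuterApproximation in
  classical
  have : SecondCountableTopology H := UniformSpace.secondCountable_of_separable H
  have : Nonempty Z := hZ_nonempty.to_subtype
  obtain ⟨z₀, hz₀⟩ := hZ_nonempty
  have hconv : ∀ᵐ ω ∂P, ∃ a ∈ Z, WeaklyConverges (fun n => x n ω) a := by
    filter_upwards [hcluster, ae_all_iff.2 fun i : ℕ =>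
      hx.ae_exists_tendsto_norm_sub_sq (TopologicalSpace.denseSeq Z i).2
        (hsum _ (TopologicalSpace.denseSeq Z i).2)] with ω h1 h2
    exact exists_weaklyConverges_of_forall_tendsto_dist ⟨z₀, hz₀⟩
      (fun z hz => exists_tendsto_norm_sub_sq_of_denseRange
        (TopologicalSpace.denseRange_denseSeq Z) h2 hz) h1
  obtain ⟨A, hA, hAmeas, hPA⟩ : ∃ A ⊆ {ω | ∃ a ∈ Z, WeaklyConverges (fun n => x n ω) a},
      MeasurableSet A ∧ P Aᶜ = 0 := by
    obtain ⟨B, hB, hBmeas, hPB⟩ := exists_measurable_superset_of_null (ae_iff.1 hconv)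
    exact ⟨Bᶜ, fun ω hω => not_not.1 fun h => hω (hB h), hBmeas.compl, by rwa [compl_compl]⟩
  have hAae : ∀ᵐ ω ∂P, ω ∈ A := ae_iff.2 hPA
  choose! y hy using fun ω (hω : ω ∈ A) => hA hω
  let xlim : Ω → H := A.piecewise y fun _ => z₀
  have hlim_mem : ∀ ω, xlim ω ∈ Z := fun ω => by
    by_cases hω : ω ∈ A
    · simpa [xlim, hω] using (hy ω hω).1
    · simpa [xlim, hω] using hz₀
  have hlim_meas : Measurable xlim := by
    -- Replacing the iterates by `z₀` off the measurable set `A` makes weak convergence hold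
    -- everywhere.
    refine measurable_of_forall_weaklyConverges (x := fun n => A.piecewise (x n) fun _ => z₀)
      (fun n => (hx.measurable_iterate n).piecewise hAmeas measurable_const) fun ω => ?_
    by_cases hω : ω ∈ A
    · simpa [xlim, hω] using (hy ω hω).2
    · simp [xlim, hω, WeaklyConverges]
  have hlim : ∀ᵐ ω ∂P, WeaklyConverges (fun n => x n ω) (xlim ω) := by
    filter_upwards [hAae] with ω hω
    simpa [xlim, hω] using (hy ω hω).2
  refine ⟨xlim, hlim_meas, hlim_mem, hlim, fun hE => ?_⟩
  obtain ⟨C, hC⟩ := hx.exists_integral_norm_sq_le hz₀ (hE z₀ hz₀)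
  have hmem := memLp_two_of_ae_weaklyConverges hx.memLp_iterate hC
    hlim_meas.stronglyMeasurable.aestronglyMeasurable hlim
  exact ⟨hx.memLp_iterate, hmem, weaklyConverges_toLp_of_ae hx.memLp_iterate hC hmem hlim⟩
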